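/- Let $X=(X_1,X_2):\mathbb R^2\to\mathbb R^2$, $$X_1(a_1,a_2)=2\bigl(\cos 2\pi a_1+\cos 2\pi(a_1-a_2)\bigr),\qquad X_2(a_1,a_2)=2\bigl(\cos 2\pi a_2+\cos 2\pi(2a_1-a_2)\bigr),$$ where $(a_1,a_2)$ are the coordinates of a point in the basis of simple coroots of the root system $C_2$. Let $W$ be the Weyl group of $C_2$, generated in these coordinates by $r_1(a_1,a_2)=(a_2-a_1,a_2)$ and $r_2(a_1,a_2)=(a_1,2a_1-a_2)$; let $F=\{(a_1,a_2): 2a_1-a_2\ge 0,\ a_2-a_1\ge 0,\ 2a_1\le 1\}$ be the fundamental domain of the affine Weyl group $\mathbb Z^2\rtimes W$, let $\Omega=X(F)$, and let $$K(y_1,y_2)=(y_1^2-4y_2)\bigl((y_2+4)^2-4y_1^2\bigr).$$ Then $\Omega$ is the compact region bounded by two lines and a parabola, $$\Omega=\Bigl\{(y_1,y_2)\in\mathbb R^2:\ |y_1|\le 4,\ -2y_1-4\le y_2,\ 2y_1-4\le y_2,\ y_2\le \tfrac14 y_1^2\Bigr\}.$$ For an integer $M\ge 1$ let $I_M=\{[s_0,s_1,s_2]\in(\mathbb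 Z^{\ge 0})^3: s_0+2s_1+s_2=M\}$. For $j=[s_0,s_1,s_2]\in I_M$ put $x^{(j)}=\bigl(\frac{2s_1+s_2}{2M},\frac{s_1+s_2}{M}\bigr)$ and $y^{(j)}=X(x^{(j)})$, and let $\varepsilon_j$ be the number of points in the $W$-orbit of $x^{(j)}$ on the torus $\mathbb R^2/\mathbb Z^2$. Let $\Pi_{2M-1}$ be the space of polynomials $p\in\mathbb C[y_1,y_2]$ all of whose monomials $y_1^{\lambda_1}y_2^{\lambda_2}$ satisfy $\lambda_1+2\lambda_2\le 2M-1$. Then for every $M\ge1$ and every $p\in\Pi_{2M-1}$ the function $pK^{-1/2}$ is integrable on $\Omega$ and $$\int_\Omega p(y_1,y_2)\,K^{-1/2}(y_1,y_2)\,dy_1\,dy_2=\frac{\pi^2}{4M^2}\sum_{j\in I_M}\varepsilon_j\,p\bigl(y^{(j)}\bigr).$$ -/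

import Mathlib

/-! The root system `C₂`. A point `x = a₁ α₁^∨ + a₂ α₂^∨` of the plane is represented by its
coordinates `a = (a₁, a₂)` in the basis of simple coroots, where
`⟨α₁, α₁⟩ = 1`, `⟨α₂, α₂⟩ = 2`, `⟨α₁, α₂⟩ = -1`, `α₁^∨ = 2 α₁`, `α₂^∨ = α₂`. -/

namespace C2

/-- The functional `x ↦ ⟨x, α₁⟩`, i.e. `a ↦ 2 a₁ - a₂`. -/
noncomputable def root1 : Module.Dual ℝ (ℝ × ℝ) :=
  (2 : ℝ) • LinearMap.fst ℝ ℝ ℝ - LinearMap.snd ℝ ℝ ℝ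

/-- The functional `x ↦ ⟨x, α₂⟩`, i.e. `a ↦ -2 a₁ + 2 a₂`. -/
noncomputable def root2 : Module.Dual ℝ (ℝ × ℝ) :=
  (-2 : ℝ) • LinearMap.fst ℝ ℝ ℝ + (2 : ℝ) • LinearMap.snd ℝ ℝ ℝ

theorem root1_apply (a : ℝ × ℝ) : root1 a = 2 * a.1 - a.2 := by
  simp [root1]

theorem root2_apply (a : ℝ × ℝ) : root2 a = -2 * a.1 + 2 * a.2 := by
  simp [root2]

theorem root1_coroot1 : root1 ((1, 0) : ℝ × ℝ) = 2 := by
  norm_num [root1_apply]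

theorem root2_coroot2 : root2 ((0, 1) : ℝ × ℝ) = 2 := by
  norm_num [root2_apply]

/-- The Weyl group, generated by the reflections `r_i x = x - ⟨x, α_i⟩ α_i^∨`. -/
noncomputable def weylGroup : Subgroup ((ℝ × ℝ) ≃ₗ[ℝ] (ℝ × ℝ)) :=
  Subgroup.closure {Module.reflection root1_coroot1, Module.reflection root2_coroot2}

/-- The coroot lattice `Q^∨ = ℤ α₁^∨ + ℤ α₂^∨`. -/
def corootLattice : AddSubgroup (ℝ × ℝ) :=
  (AddSubgroup.zmultiples (1 : ℝ)).prod (AddSubgroup.zmultiples (1 : ℝ))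

/-- `ε(x)`: the number of points in the Weyl group orbit of `x` on the torus `ℝ² / Q^∨`. -/
noncomputable def orbitSize (a : ℝ × ℝ) : ℕ :=
  Set.ncard {q : (ℝ × ℝ) ⧸ corootLattice | ∃ w ∈ weylGroup, q = QuotientAddGroup.mk (w a)}

/-- The fundamental domain of the affine Weyl group:
`⟨x, α₁⟩ ≥ 0`, `⟨x, α₂⟩ ≥ 0`, `⟨x, ξ⟩ ≤ 1` with the highest root `ξ = 2 α₁ + α₂`. -/
def fundDomain : Set (ℝ × ℝ) :=
  {a | 0 ≤ root1 a ∧ 0 ≤ root2 a ∧ 2 * root1 a + root2 a ≤ 1}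

/-- The map `X = (X₁, X₂)` formed by the orbit functions of the two fundamental weights. -/
noncomputable def X (a : ℝ × ℝ) : ℝ × ℝ :=
  (2 * (Real.cos (2 * Real.pi * a.1) + Real.cos (2 * Real.pi * (a.1 - a.2))),
   2 * (Real.cos (2 * Real.pi * a.2) + Real.cos (2 * Real.pi * (2 * a.1 - a.2))))

/-- The integration domain `Ω = X(F)`. -/
noncomputable def Omega : Set (ℝ × ℝ) := X '' fundDomain

/-- The weight polynomial. -/
def K (y : ℝ × ℝ) : ℝ := (y.1 ^ 2 - 4 * y.2) * ((y.2 + 4) ^ 2 - 4 * y.1 ^ 2)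

/-- The index set of all `[s₀, s₁, s₂]` with `s₀ + 2 s₁ + s₂ = M`. -/
def indexSet (M : ℕ) : Finset (ℕ × ℕ × ℕ) :=
  (Finset.range (M + 1) ×ˢ Finset.range (M + 1) ×ˢ Finset.range (M + 1)).filter
    fun s => s.1 + 2 * s.2.1 + s.2.2 = M

theorem mem_indexSet (M : ℕ) (s : ℕ × ℕ × ℕ) :
    s ∈ indexSet M ↔ s.1 + 2 * s.2.1 + s.2.2 = M := by
  simp only [indexSet, Finset.mem_filter, Finset.mem_product, Finset.mem_range]
  omega

/-- The grid point `(s₁/M) ω₁^∨ + (s₂/M) ω₂^∨`, where `ω₁^∨ = (1, 1)` and `ω₂^∨ = (1/2, 1)`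
in the basis of simple coroots. -/
noncomputable def gridPoint (M : ℕ) (s : ℕ × ℕ × ℕ) : ℝ × ℝ :=
  ((2 * (s.2.1 : ℝ) + s.2.2) / (2 * M), ((s.2.1 : ℝ) + s.2.2) / M)

/-- The value of a complex polynomial in two variables at a point of the real plane. -/
noncomputable def evalAt (p : MvPolynomial (Fin 2) ℂ) (y : ℝ × ℝ) : ℂ :=
  MvPolynomial.eval ![(y.1 : ℂ), (y.2 : ℂ)] p

/-- The space `Π_N` of complex polynomials of `m`-degree at most `N`; the monomial
`y₁^{λ₁} y₂^{λ₂}` has `m`-degree `λ₁ + 2 λ₂`, since the highest dual root is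
`η = α₁^∨ + 2 α₂^∨`. -/
def PolySpace (N : ℕ) : Set (MvPolynomial (Fin 2) ℂ) :=
  {p | ∀ d ∈ p.support, d 0 + 2 * d 1 ≤ N}

end C2

/-! With `x = 2 cos t₁`, `z = 2 cos t₂`, where `t = (2π a₁, 2π (a₂ - a₁))`, the map `X` becomes `(x
+ z, x z)`. Both the region and the weight then concern the roots `x`, `z` of a quadratic. `K` is
the square of the Jacobian (`K_angleMap`), so the weighted integral over `Ω` is an unweighted
integral over `chamber`, half of that over `[0, π]²`.

A monomial `y₁^λ₁ y₂^λ₂` is homogeneous of degree `λ₁ + 2 λ₂` in `x`, `z`, so it suffices to treat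
`x^i z^j` with `i + j < 2M`. By orthogonality of characters, averaging over the pairs of residues
modulo `2M` of equal parity gives the exact mean (`sum_torusGrid_node_pow`).

The Weyl group acts on `t` by signed permutations, so its orbits on this grid are the fibres of
`foldIndex`. Their sizes are the weights `ε_j` (`orbitSize_gridPoint`). -/

namespace C2

open Real Set MeasureTheory

/-! ### Angular coordinates and the shape of `Ω`. -/

/-- The map `X` in the angular coordinates `t = (2π a₁, 2π (a₂ - a₁))`, in which the Weyl group
acts by signed permutations. -/
noncomputable def angleMap (t : ℝ × ℝ) : ℝ × ℝ :=
  (2 * cos t.1 + 2 * cos t.2, 2 * cos t.1 * (2 * cos t.2))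

/-- The fundamental domain in angular coordinates. -/
def chamber : Set (ℝ × ℝ) := {t | 0 ≤ t.2 ∧ t.2 ≤ t.1 ∧ t.1 ≤ π}

theorem X_eq_angleMap (a : ℝ × ℝ) :
    X a = angleMap (2 * π * a.1, 2 * π * (a.2 - a.1)) := by
  have h1 : cos (2 * π * (a.1 - a.2)) = cos (2 * π * (a.2 - a.1)) := by
    rw [← cos_neg]; ring_nf
  have h2 : 2 * π * a.2 = 2 * π * a.1 + 2 * π * (a.2 - a.1) := by ring
  have h3 : 2 * π * (2 * a.1 - a.2) = 2 * π * a.1 - 2 * π * (a.2 - a.1) := by ring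
  simp only [X, angleMap, h1, h3]
  rw [h2, cos_add, cos_sub]
  ext <;> ring_nf

theorem Omega_eq_image_chamber : Omega = angleMap '' chamber := by
  have hpi := pi_pos
  ext y
  constructor
  · rintro ⟨a, ⟨h1, h2, h3⟩, rfl⟩
    rw [root1_apply] at h1 h3
    rw [root2_apply] at h2 h3
    refine ⟨_, ⟨?_, ?_, ?_⟩, (X_eq_angleMap a).symm⟩ <;> dsimp only <;> nlinarith
  · rintro ⟨t, ⟨h1, h2, h3⟩, rfl⟩
    refine ⟨(t.1 / (2 * π), (t.1 + t.2) / (2 * π)), ⟨?_, ?_, ?_⟩, ?_⟩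
    · rw [root1_apply]
      have : 2 * (t.1 / (2 * π)) - (t.1 + t.2) / (2 * π) = (t.1 - t.2) / (2 * π) := by ring
      dsimp only
      rw [this]
      exact div_nonneg (by linarith) (by positivity)
    · rw [root2_apply]
      have : -2 * (t.1 / (2 * π)) + 2 * ((t.1 + t.2) / (2 * π)) = t.2 / π := by field_simp; ring
      dsimp only
      rw [this]
      exact div_nonneg h1 hpi.le
    · rw [root1_apply, root2_apply]
      have : 2 * (2 * (t.1 / (2 * π)) - (t.1 + t.2) / (2 * π)) +
          (-2 * (t.1 / (2 * π)) + 2 * ((t.1 + t.2) / (2 * π))) = t.1 / π := by field_simp; ring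
      dsimp only
      rw [this, div_le_one hpi]
      exact h3
    · rw [X_eq_angleMap]
      congr 1
      ext
      · dsimp only
        field_simp
      · dsimp only
        field_simp
        ring

/-- A point lies in `Ω` when the roots of `T² - y₁ T + y₂` are real and in `[-2, 2]`. The parabola
is the discriminant condition, and the lines say `(2 ∓ x)(2 ∓ z) ≥ 0`. -/
theorem Omega_eq_region :
    Omega = {y : ℝ × ℝ | |y.1| ≤ 4 ∧ -2 * y.1 - 4 ≤ y.2 ∧ 2 * y.1 - 4 ≤ y.2 ∧
      y.2 ≤ y.1 ^ 2 / 4} := by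
  rw [Omega_eq_image_chamber]
  ext ⟨y₁, y₂⟩
  constructor
  · rintro ⟨t, -, h⟩
    obtain ⟨rfl, rfl⟩ := Prod.mk.inj h
    have a1 := neg_one_le_cos t.1
    have a2 := cos_le_one t.1
    have b1 := neg_one_le_cos t.2
    have b2 := cos_le_one t.2
    refine ⟨abs_le.2 ⟨?_, ?_⟩, ?_, ?_, ?_⟩ <;> dsimp only
    · linarith
    · linarith
    · nlinarith
    · nlinarith
    · nlinarith [sq_nonneg (cos t.1 - cos t.2)]
  · rintro ⟨h1, h2, h3, h4⟩
    dsimp only at h1 h2 h3 h4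
    rw [abs_le] at h1
    have hs := sq_sqrt (show 0 ≤ y₁ ^ 2 - 4 * y₂ by linarith)
    have hs0 := sqrt_nonneg (y₁ ^ 2 - 4 * y₂)
    set r := √(y₁ ^ 2 - 4 * y₂)
    obtain ⟨x, hx⟩ : ∃ x, x = (y₁ - r) / 2 := ⟨_, rfl⟩
    obtain ⟨z, hz⟩ : ∃ z, z = (y₁ + r) / 2 := ⟨_, rfl⟩
    have hxz : x ≤ z := by linarith
    have e1 : x + z = y₁ := by linarith
    have e2 : x * z = y₂ := by rw [hx, hz]; linarith
    have p1 : 0 ≤ (2 - x) * (2 - z) := by nlinarith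
    have p2 : 0 ≤ (2 + x) * (2 + z) := by nlinarith
    -- The bound `|y₁| ≤ 4` rules out both roots lying beyond the same end of `[-2, 2]`.
    have z2 : z ≤ 2 := by
      by_contra! hc
      have : 2 ≤ x := by by_contra! h; nlinarith
      linarith
    have x2 : -2 ≤ x := by
      by_contra! hc
      have : z ≤ -2 := by by_contra! h; nlinarith
      linarith
    refine ⟨(arccos (x / 2), arccos (z / 2)), ⟨arccos_nonneg _, ?_, arccos_le_pi _⟩, ?_⟩
    · exact antitone_arccos (by linarith)
    · simp only [angleMap]
      rw [cos_arccos (by linarith) (by linarith), cos_arccos (by linarith) (by linarith)]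
      ext <;> dsimp only <;> linarith

/-- Sum and product determine two numbers up to order, and `t.2 ≤ t.1` fixes the order of the
cosines. -/
theorem injOn_angleMap : InjOn angleMap chamber := by
  rintro ⟨t₁, t₂⟩ ⟨h1, h2, h3⟩ ⟨u₁, u₂⟩ ⟨k1, k2, k3⟩ h
  dsimp only at h1 h2 h3 k1 k2 k3
  obtain ⟨e1, e2⟩ := Prod.mk.inj h
  dsimp only at e1 e2
  have ht := cos_le_cos_of_nonneg_of_le_pi h1 h3 h2
  have hu := cos_le_cos_of_nonneg_of_le_pi k1 k3 k2
  have hsq : (cos t₂ - cos t₁) ^ 2 = (cos u₂ - cos u₁) ^ 2 := by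
    have : (cos t₁ + cos t₂) ^ 2 = (cos u₁ + cos u₂) ^ 2 := by
      congr 1; linarith
    nlinarith
  have hd : cos t₂ - cos t₁ = cos u₂ - cos u₁ :=
    (sq_eq_sq₀ (by linarith) (by linarith)).1 hsq
  have c1 : cos t₁ = cos u₁ := by linarith
  have c2 : cos t₂ = cos u₂ := by linarith
  rw [injOn_cos ⟨h1.trans h2, h3⟩ ⟨k1.trans k2, k3⟩ c1,
    injOn_cos ⟨h1, h2.trans h3⟩ ⟨k1, k2.trans k3⟩ c2]

/-! ### Jacobian and change of variables. -/

/-- The derivative of `angleMap`. -/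
noncomputable def fderivAngleMap (t : ℝ × ℝ) : ℝ × ℝ →L[ℝ] ℝ × ℝ :=
  (Matrix.toLin (.finTwoProd ℝ) (.finTwoProd ℝ)
    !![-(2 * sin t.1), -(2 * sin t.2);
      -(4 * sin t.1 * cos t.2), -(4 * cos t.1 * sin t.2)]).toContinuousLinearMap

theorem hasFDerivAt_angleMap (t : ℝ × ℝ) : HasFDerivAt angleMap (fderivAngleMap t) t := by
  unfold fderivAngleMap
  rw [Matrix.toLin_finTwoProd_toContinuousLinearMap]
  have h1 : HasFDerivAt (fun t : ℝ × ℝ => 2 * cos t.1) _ t :=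
    ((hasDerivAt_cos t.1).const_mul 2).comp_hasFDerivAt t
      (ContinuousLinearMap.fst ℝ ℝ ℝ).hasFDerivAt
  have h2 : HasFDerivAt (fun t : ℝ × ℝ => 2 * cos t.2) _ t :=
    ((hasDerivAt_cos t.2).const_mul 2).comp_hasFDerivAt t
      (ContinuousLinearMap.snd ℝ ℝ ℝ).hasFDerivAt
  refine ((h1.add h2).prodMk (h1.mul h2)).congr_fderiv ?_
  ext <;> simp <;> ring

theorem det_fderivAngleMap (t : ℝ × ℝ) :
    (fderivAngleMap t).det = 8 * sin t.1 * sin t.2 * (cos t.1 - cos t.2) := by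
  simp only [fderivAngleMap, LinearMap.det_toContinuousLinearMap, LinearMap.det_toLin,
    Matrix.det_fin_two_of]
  ring

/-- The factors of `K` are `(x - z)²` and `(4 - x²)(4 - z²)`. -/
theorem K_angleMap (t : ℝ × ℝ) : K (angleMap t) = (fderivAngleMap t).det ^ 2 := by
  rw [det_fderivAngleMap]
  have h1 := sin_sq t.1
  have h2 := sin_sq t.2
  simp only [K, angleMap, mul_pow, h1, h2]
  ring

theorem abs_det_mul_K_rpow {t : ℝ × ℝ} (h : (fderivAngleMap t).det ≠ 0) :
    |(fderivAngleMap t).det| * K (angleMap t) ^ (-(1 / 2) : ℝ) = 1 := by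
  rw [K_angleMap, ← sq_abs, rpow_neg (by positivity), ← sqrt_eq_rpow, sqrt_sq (abs_nonneg _)]
  exact mul_inv_cancel₀ (abs_ne_zero.2 h)

theorem volume_diagonal_eq_zero : volume {t : ℝ × ℝ | t.1 = t.2} = 0 := by
  have : {t : ℝ × ℝ | t.1 = t.2} =
      (LinearMap.ker (LinearMap.fst ℝ ℝ ℝ - LinearMap.snd ℝ ℝ ℝ) : Set (ℝ × ℝ)) := by
    ext t; simp [sub_eq_zero]
  rw [this]
  apply Measure.addHaar_submodule
  rw [Ne, LinearMap.ker_eq_top]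
  intro h
  simpa using LinearMap.congr_fun h (1, 0)

theorem ae_fst_ne (c : ℝ) : ∀ᵐ t : ℝ × ℝ, t.1 ≠ c := by
  have : {t : ℝ × ℝ | ¬ t.1 ≠ c} = {c} ×ˢ univ := by ext; simp
  rw [ae_iff, this, Measure.volume_eq_prod, Measure.prod_prod]
  simp

theorem ae_snd_ne (c : ℝ) : ∀ᵐ t : ℝ × ℝ, t.2 ≠ c := by
  have : {t : ℝ × ℝ | ¬ t.2 ≠ c} = univ ×ˢ {c} := by ext; simp
  rw [ae_iff, this, Measure.volume_eq_prod, Measure.prod_prod]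
  simp

theorem isClosed_chamber : IsClosed chamber :=
  (isClosed_le continuous_const continuous_snd).inter
    ((isClosed_le continuous_snd continuous_fst).inter
      (isClosed_le continuous_fst continuous_const))

theorem chamber_subset : chamber ⊆ Icc 0 π ×ˢ Icc 0 π :=
  fun _ ⟨h1, h2, h3⟩ => ⟨⟨h1.trans h2, h3⟩, ⟨h1, h2.trans h3⟩⟩

/-- The Jacobian vanishes only on the walls of the chamber, a null set. There the real power of `K =
0` has the default value `0`, and the cancellation fails. -/
theorem ae_det_fderivAngleMap_ne_zero :
    ∀ᵐ t ∂(volume.restrict chamber), (fderivAngleMap t).det ≠ 0 := by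
  rw [ae_restrict_iff' isClosed_chamber.measurableSet]
  have hd : ∀ᵐ t : ℝ × ℝ, t.1 ≠ t.2 := by
    rw [ae_iff]; simpa using volume_diagonal_eq_zero
  filter_upwards [hd, ae_fst_ne π, ae_snd_ne 0] with t h1 h2 h3 ht
  obtain ⟨k1, k2, k3⟩ := ht
  have l3 : 0 < t.2 := lt_of_le_of_ne k1 (Ne.symm h3)
  have l1 : t.2 < t.1 := lt_of_le_of_ne k2 (Ne.symm h1)
  have l2 : t.1 < π := lt_of_le_of_ne k3 h2
  rw [det_fderivAngleMap]
  have s1 := sin_pos_of_pos_of_lt_pi (l3.trans l1) l2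
  have s2 := sin_pos_of_pos_of_lt_pi l3 (l1.trans l2)
  have c := cos_lt_cos_of_nonneg_of_le_pi l3.le l2.le l1
  have : cos t.1 - cos t.2 ≠ 0 := by linarith
  positivity

theorem continuous_angleMap : Continuous angleMap := by
  unfold angleMap; fun_prop

theorem integrableOn_square {f : ℝ × ℝ → ℂ} (hf : Continuous f) :
    IntegrableOn f (Icc 0 π ×ˢ Icc 0 π) :=
  hf.continuousOn.integrableOn_compact (isCompact_Icc.prod isCompact_Icc)

theorem abs_det_smul_ae_eq (f : ℝ × ℝ → ℂ) :
    (fun t => |(fderivAngleMap t).det| •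
      (f (angleMap t) * ((K (angleMap t) ^ (-(1 / 2) : ℝ) : ℝ) : ℂ)))
      =ᵐ[volume.restrict chamber] fun t => f (angleMap t) := by
  filter_upwards [ae_det_fderivAngleMap_ne_zero] with t ht
  rw [Complex.real_smul, mul_left_comm, ← Complex.ofReal_mul, abs_det_mul_K_rpow ht]
  simp

theorem integrableOn_Omega {f : ℝ × ℝ → ℂ} (hf : Continuous f) :
    IntegrableOn (fun y => f y * ((K y ^ (-(1 / 2) : ℝ) : ℝ) : ℂ)) Omega := by
  rw [Omega_eq_image_chamber, integrableOn_image_iff_integrableOn_abs_det_fderiv_smul volume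
    isClosed_chamber.measurableSet (fun t _ => (hasFDerivAt_angleMap t).hasFDerivWithinAt)
    injOn_angleMap]
  refine Integrable.congr ?_ (abs_det_smul_ae_eq f).symm
  exact (integrableOn_square (hf.comp continuous_angleMap)).mono_set chamber_subset

theorem integral_Omega (f : ℝ × ℝ → ℂ) :
    ∫ y in Omega, f y * ((K y ^ (-(1 / 2) : ℝ) : ℝ) : ℂ) = ∫ t in chamber, f (angleMap t) := by
  rw [Omega_eq_image_chamber, integral_image_eq_integral_abs_det_fderiv_smul volume
    isClosed_chamber.measurableSet (fun t _ => (hasFDerivAt_angleMap t).hasFDerivWithinAt)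
    injOn_angleMap]
  exact integral_congr_ae (abs_det_smul_ae_eq f)

/-- The integral of a function invariant under exchange of the coordinates over the square is twice
its integral over the chamber. -/
theorem integral_square_of_swap {g : ℝ × ℝ → ℂ} (hg : Continuous g)
    (hswap : ∀ t, g t.swap = g t) :
    ∫ t in Icc 0 π ×ˢ Icc 0 π, g t = 2 * ∫ t in chamber, g t := by
  have hU : Icc 0 π ×ˢ Icc 0 π = chamber ∪ Prod.swap ⁻¹' chamber := by
    ext ⟨a, b⟩
    simp only [chamber, mem_prod, mem_Icc, mem_union, mem_preimage, mem_ofPred_eq, Prod.swap]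
    constructor
    · rintro ⟨⟨h1, h2⟩, h3, h4⟩
      rcases le_total b a with h | h
      · exact .inl ⟨h3, h, h2⟩
      · exact .inr ⟨h1, h, h4⟩
    · rintro (⟨h1, h2, h3⟩ | ⟨h1, h2, h3⟩) <;> refine ⟨⟨?_, ?_⟩, ?_, ?_⟩ <;> linarith
  have hd : AEDisjoint volume chamber (Prod.swap ⁻¹' chamber) :=
    measure_mono_null (fun t ht => le_antisymm ht.2.2.1 ht.1.2.1) volume_diagonal_eq_zero
  have hi := integrableOn_square hg
  have hs : ∫ t in Prod.swap ⁻¹' chamber, g t = ∫ t in chamber, g t := by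
    have hmp : MeasurePreserving (Prod.swap : ℝ × ℝ → ℝ × ℝ) volume volume :=
      Measure.measurePreserving_swap
    rw [← hmp.setIntegral_preimage_emb (MeasurableEquiv.prodComm.measurableEmbedding) g chamber]
    simp only [hswap]
  have hm : MeasurableSet (Prod.swap ⁻¹' chamber) :=
    measurable_swap isClosed_chamber.measurableSet
  rw [hU] at hi ⊢
  rw [setIntegral_union₀ hd hm.nullMeasurableSet (hi.mono_set subset_union_left)
    (hi.mono_set subset_union_right), hs]
  ring

/-! ### Moments of the cosine. -/

/-- The mean value of `(2 cos θ) ^ i`: the central binomial coefficient for even `i`, zero for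
odd `i`. -/
noncomputable def cosMoment (i : ℕ) : ℂ :=
  ∑ k ∈ Finset.range (i + 1), if 2 * k = i then (i.choose k : ℂ) else 0

theorem two_mul_cos_pow (i : ℕ) (θ : ℝ) :
    (2 * cos θ) ^ i =
      ∑ k ∈ Finset.range (i + 1), (i.choose k : ℝ) * cos (((2 * k - i : ℤ) : ℝ) * θ) := by
  have h : (((2 * cos θ) ^ i : ℝ) : ℂ) = ∑ k ∈ Finset.range (i + 1),
      ((i.choose k : ℝ) : ℂ) * Complex.exp (((((2 * k - i : ℤ) : ℝ) * θ : ℝ) : ℂ) * Complex.I) := by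
    push_cast
    rw [Complex.two_cos, add_pow]
    refine Finset.sum_congr rfl fun k hk => ?_
    have hk' : k ≤ i := Nat.lt_succ_iff.1 (Finset.mem_range.1 hk)
    rw [← Complex.exp_nat_mul, ← Complex.exp_nat_mul, ← Complex.exp_add, mul_comm]
    congr 2
    push_cast [hk']
    ring
  have := congrArg Complex.re h
  rw [Complex.ofReal_re, Complex.re_sum] at this
  rw [this]
  refine Finset.sum_congr rfl fun k _ => ?_
  rw [Complex.re_ofReal_mul, Complex.exp_ofReal_mul_I_re]

theorem integral_cos_int_mul (n : ℤ) :
    ∫ θ in (0 : ℝ)..π, cos ((n : ℝ) * θ) = if n = 0 then π else 0 := by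
  split_ifs with h
  · simp [h]
  · have hn : (n : ℝ) ≠ 0 := by exact_mod_cast h
    rw [intervalIntegral.integral_comp_mul_left (fun x => cos x) hn, integral_cos]
    simp [sin_int_mul_pi]

theorem integral_two_mul_cos_pow (i : ℕ) :
    ∫ θ in Icc 0 π, ((2 * cos θ : ℝ) : ℂ) ^ i = π * cosMoment i := by
  rw [integral_Icc_eq_integral_Ioc, ← intervalIntegral.integral_of_le pi_pos.le]
  have : ∀ θ : ℝ, ((2 * cos θ : ℝ) : ℂ) ^ i = (((2 * cos θ) ^ i : ℝ) : ℂ) := by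
    intro θ; push_cast; rfl
  simp_rw [this]
  rw [intervalIntegral.integral_ofReal]
  simp_rw [two_mul_cos_pow]
  rw [intervalIntegral.integral_finsetSum
    (fun k _ => (by fun_prop : Continuous _).intervalIntegrable _ _)]
  simp_rw [intervalIntegral.integral_const_mul, integral_cos_int_mul]
  rw [cosMoment, Complex.ofReal_sum, Finset.mul_sum]
  refine Finset.sum_congr rfl fun k _ => ?_
  have : ((2 * k - i : ℤ) = 0) ↔ 2 * k = i := by omega
  simp only [this]
  split_ifs <;> simp [mul_comm]

/-! ### Character sums over `ZMod N`. -/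

section DiscreteSums

variable {N : ℕ} [NeZero N]

/-- The value of `2 cos` at the `N`-division point of the circle with index `m`. -/
noncomputable def node (m : ZMod N) : ℝ := 2 * cos (2 * π * m.valMinAbs / N)

theorem node_eq (m : ZMod N) :
    (node m : ℂ) = ZMod.stdAddChar m + ZMod.stdAddChar (-m) := by
  have h : ∀ j : ℤ, (ZMod.stdAddChar (j : ZMod N)) =
      Complex.exp (((2 * π * j / N : ℝ) : ℂ) * Complex.I) := by
    intro j
    rw [ZMod.stdAddChar_coe]
    push_cast
    ring_nf
  have h1 := h m.valMinAbs
  have h2 := h (-m.valMinAbs)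
  rw [ZMod.coe_valMinAbs] at h1
  rw [Int.cast_neg, ZMod.coe_valMinAbs] at h2
  rw [h1, h2, node]
  push_cast
  rw [Complex.two_cos]
  ring_nf

theorem node_pow (m : ZMod N) (i : ℕ) :
    (node m : ℂ) ^ i = ∑ k ∈ Finset.range (i + 1),
      (i.choose k : ℂ) * ZMod.stdAddChar (m * ((2 * k - i : ℤ) : ZMod N)) := by
  rw [node_eq, add_pow]
  refine Finset.sum_congr rfl fun k hk => ?_
  have hk' : k ≤ i := Nat.lt_succ_iff.1 (Finset.mem_range.1 hk)
  rw [← AddChar.map_nsmul_eq_pow, ← AddChar.map_nsmul_eq_pow, ← AddChar.map_add_eq_mul, mul_comm]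
  congr 2
  simp only [nsmul_eq_mul]
  push_cast [hk']
  ring

/-- The twist `c = 0` gives the plain power sums; `c = M` with `N = 2M` gives the sums with
alternating signs. -/
theorem sum_stdAddChar_mul_node_pow (c : ℤ) (i : ℕ) :
    ∑ m : ZMod N, ZMod.stdAddChar (m * (c : ZMod N)) * (node m : ℂ) ^ i =
      N * ∑ k ∈ Finset.range (i + 1),
        if (N : ℤ) ∣ c + (2 * k - i) then (i.choose k : ℂ) else 0 := by
  simp_rw [node_pow, Finset.mul_sum]
  rw [Finset.sum_comm]
  refine Finset.sum_congr rfl fun k _ => ?_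
  have : ∀ m : ZMod N, ZMod.stdAddChar (m * (c : ZMod N)) *
      ((i.choose k : ℂ) * ZMod.stdAddChar (m * ((2 * k - i : ℤ) : ZMod N))) =
      (i.choose k : ℂ) * ZMod.stdAddChar (m * ((c + (2 * k - i) : ℤ) : ZMod N)) := by
    intro m
    rw [Int.cast_add, mul_add, AddChar.map_add_eq_mul]
    ring
  simp_rw [this]
  rw [← Finset.mul_sum, AddChar.sum_mulShift _ (ZMod.isPrimitive_stdAddChar N), ZMod.card]
  simp only [ZMod.intCast_zmod_eq_zero_iff_dvd]
  split_ifs <;> simp [mul_comm]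

theorem sum_node_pow {i : ℕ} (hi : i < N) :
    ∑ m : ZMod N, (node m : ℂ) ^ i = N * cosMoment i := by
  have h := sum_stdAddChar_mul_node_pow (N := N) 0 i
  simp only [Int.cast_zero, mul_zero, AddChar.map_zero_eq_one, one_mul] at h
  rw [h, cosMoment]
  congr 1
  refine Finset.sum_congr rfl fun k hk => ?_
  have hk' : k ≤ i := Nat.lt_succ_iff.1 (Finset.mem_range.1 hk)
  -- No aliasing: `|2k - i| ≤ i < N`.
  have : (N : ℤ) ∣ 0 + (2 * k - i) ↔ 2 * k = i := by
    constructor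
    · intro hd
      have := Int.eq_zero_of_abs_lt_dvd hd (by rw [abs_lt]; constructor <;> omega)
      omega
    · intro h
      have : (0 + (2 * k - i) : ℤ) = 0 := by omega
      rw [this]; exact dvd_zero _
  simp only [this]

end DiscreteSums

/-! ### Exactness of the grid average on the square. -/

section Quadrature

variable {M : ℕ} [NeZero M]

theorem sum_sign_mul_node_pow {i : ℕ} (hi : i < M) :
    ∑ m : ZMod (2 * M), (-1 : ℂ) ^ m.valMinAbs.natAbs * (node m : ℂ) ^ i = 0 := by
  have hM : (M : ℂ) ≠ 0 := Nat.cast_ne_zero.2 (NeZero.ne M)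
  have hsign : ∀ m : ZMod (2 * M),
      (-1 : ℂ) ^ m.valMinAbs.natAbs = ZMod.stdAddChar (m * ((M : ℤ) : ZMod (2 * M))) := by
    intro m
    have hhalf : ZMod.stdAddChar ((M : ℤ) : ZMod (2 * M)) = -1 := by
      rw [ZMod.stdAddChar_coe, ← Complex.exp_pi_mul_I]
      congr 1
      push_cast
      field_simp
    have hm : m * ((M : ℤ) : ZMod (2 * M)) = m.valMinAbs • ((M : ℤ) : ZMod (2 * M)) := by
      rw [zsmul_eq_mul, ZMod.coe_valMinAbs]
    rw [hm, AddChar.map_zsmul_eq_zpow, hhalf]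
    rcases Int.natAbs_eq m.valMinAbs with h | h
    · conv_rhs => rw [h]
      rw [zpow_natCast]
    · conv_rhs => rw [h]
      rw [zpow_neg, zpow_natCast, ← inv_pow]
      norm_num
  simp_rw [hsign]
  rw [sum_stdAddChar_mul_node_pow, Finset.sum_eq_zero, mul_zero]
  intro k hk
  have hk' : k ≤ i := Nat.lt_succ_iff.1 (Finset.mem_range.1 hk)
  rw [if_neg]
  intro hd
  push_cast at hd
  -- Since `i < M`, the number `M + 2k - i` lies strictly between `0` and `2M`.
  have := Int.le_of_dvd (by omega) hd
  omega

/-- The indices of the full grid on the torus: pairs of residues modulo `2M` of equal parity. -/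
def torusGrid (M : ℕ) [NeZero M] : Finset (ZMod (2 * M) × ZMod (2 * M)) :=
  Finset.univ.filter fun q => Even (q.1.valMinAbs.natAbs + q.2.valMinAbs.natAbs)

/-- The parity indicator is `(1 + (-1)^(m + n)) / 2`. The signed part factors, and `i + j < 2M`
forces one exponent below `M`, so one factor vanishes. -/
theorem sum_torusGrid_node_pow {i j : ℕ} (h : i + j < 2 * M) :
    ∑ q ∈ torusGrid M, (node q.1 : ℂ) ^ i * (node q.2 : ℂ) ^ j =
      2 * M ^ 2 * (cosMoment i * cosMoment j) := by
  have hind : ∀ q : ZMod (2 * M) × ZMod (2 * M),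
      (if Even (q.1.valMinAbs.natAbs + q.2.valMinAbs.natAbs) then
        (node q.1 : ℂ) ^ i * (node q.2 : ℂ) ^ j else 0) =
      1 / 2 * ((node q.1 : ℂ) ^ i * (node q.2 : ℂ) ^ j +
        ((-1 : ℂ) ^ q.1.valMinAbs.natAbs * (node q.1 : ℂ) ^ i) *
        ((-1 : ℂ) ^ q.2.valMinAbs.natAbs * (node q.2 : ℂ) ^ j)) := by
    intro q
    rw [mul_mul_mul_comm, ← pow_add]
    split_ifs with hq
    · rw [hq.neg_one_pow]; ring
    · rw [(Nat.not_even_iff_odd.1 hq).neg_one_pow]; ring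
  rw [torusGrid, Finset.sum_filter]
  simp_rw [hind]
  rw [← Finset.mul_sum, Finset.sum_add_distrib, Fintype.sum_prod_type, Fintype.sum_prod_type]
  dsimp only
  rw [← Fintype.sum_mul_sum, ← Fintype.sum_mul_sum, sum_node_pow (by omega), sum_node_pow (by omega)]
  have hz : (∑ m : ZMod (2 * M), (-1 : ℂ) ^ m.valMinAbs.natAbs * (node m : ℂ) ^ i) *
      ∑ m : ZMod (2 * M), (-1 : ℂ) ^ m.valMinAbs.natAbs * (node m : ℂ) ^ j = 0 := by
    rcases lt_or_ge i M with hi | hi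
    · rw [sum_sign_mul_node_pow hi, zero_mul]
    · rw [sum_sign_mul_node_pow (i := j) (by omega), mul_zero]
  rw [hz]
  push_cast
  ring

theorem integral_square_pow (i j : ℕ) :
    ∫ t : ℝ × ℝ in Icc 0 π ×ˢ Icc 0 π, ((2 * cos t.1 : ℝ) : ℂ) ^ i * ((2 * cos t.2 : ℝ) : ℂ) ^ j =
      π ^ 2 * (cosMoment i * cosMoment j) := by
  rw [Measure.volume_eq_prod, setIntegral_prod_mul (fun θ : ℝ => ((2 * cos θ : ℝ) : ℂ) ^ i)
    (fun θ : ℝ => ((2 * cos θ : ℝ) : ℂ) ^ j), integral_two_mul_cos_pow, integral_two_mul_cos_pow]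
  ring

theorem evalAt_symm (p : MvPolynomial (Fin 2) ℂ) (x z : ℝ) :
    evalAt p (x + z, x * z) = ∑ d ∈ p.support, ∑ k ∈ Finset.range (d 0 + 1),
      p.coeff d * ((d 0).choose k : ℂ) * ((x : ℂ) ^ (k + d 1) * (z : ℂ) ^ (d 0 - k + d 1)) := by
  rw [evalAt, MvPolynomial.eval_eq']
  refine Finset.sum_congr rfl fun d _ => ?_
  simp only [Fin.prod_univ_two, Matrix.cons_val_zero, Matrix.cons_val_one, Complex.ofReal_add,
    Complex.ofReal_mul]
  rw [add_pow, Finset.sum_mul, Finset.mul_sum]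
  refine Finset.sum_congr rfl fun k _ => ?_
  ring

/-- The cubature formula on the torus, for functions of the node coordinates. -/
theorem integral_square_evalAt {p : MvPolynomial (Fin 2) ℂ} (hp : p ∈ PolySpace (2 * M - 1)) :
    ∫ t in Icc 0 π ×ˢ Icc 0 π, evalAt p (angleMap t) =
      π ^ 2 / (2 * M ^ 2) *
        ∑ q ∈ torusGrid M, evalAt p (node q.1 + node q.2, node q.1 * node q.2) := by
  have hM : 0 < M := NeZero.pos M
  have hM' : (M : ℂ) ≠ 0 := Nat.cast_ne_zero.2 hM.ne'
  simp only [angleMap, evalAt_symm]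
  rw [integral_finsetSum _ fun d _ => integrableOn_square (by fun_prop), Finset.sum_comm,
    Finset.mul_sum]
  refine Finset.sum_congr rfl fun d hd => ?_
  rw [integral_finsetSum _ fun k _ => integrableOn_square (by fun_prop), Finset.sum_comm,
    Finset.mul_sum]
  refine Finset.sum_congr rfl fun k hk => ?_
  have hk' : k ≤ d 0 := Nat.lt_succ_iff.1 (Finset.mem_range.1 hk)
  have hd' := hp d hd
  -- The two exponents add up to `d 0 + 2 * d 1 ≤ 2M - 1`.
  rw [integral_const_mul, integral_square_pow, ← Finset.mul_sum,
    sum_torusGrid_node_pow (by omega)]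
  field_simp

end Quadrature

end C2

/-! ### The Weyl group as signed permutations. -/

namespace C2

open Real

/-- The point whose orthogonal coordinates `(a₁, a₂ - a₁)` are `(u, v)`. -/
def ofOrtho (u v : ℝ) : ℝ × ℝ := (u, u + v)

/-- Two points agree up to a signed permutation of the orthogonal coordinates `(a₁, a₂ - a₁)`. -/
def SignedPerm (a b : ℝ × ℝ) : Prop :=
  (|a.1| = |b.1| ∧ |a.2 - a.1| = |b.2 - b.1|) ∨ (|a.1| = |b.2 - b.1| ∧ |a.2 - a.1| = |b.1|)

theorem reflection1_apply (a : ℝ × ℝ) :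
    Module.reflection root1_coroot1 a = (a.2 - a.1, a.2) := by
  rw [Module.reflection_apply, root1_apply]
  ext <;> simp
  ring

theorem reflection2_apply (a : ℝ × ℝ) :
    Module.reflection root2_coroot2 a = (a.1, 2 * a.1 - a.2) := by
  rw [Module.reflection_apply, root2_apply]
  ext <;> simp
  ring

theorem signedPerm_of_mem_weylGroup {w : (ℝ × ℝ) ≃ₗ[ℝ] (ℝ × ℝ)} (hw : w ∈ weylGroup) :
    ∀ a, SignedPerm a (w a) := by
  refine Subgroup.closure_induction (p := fun w _ => ∀ a, SignedPerm a (w a)) ?_ ?_ ?_ ?_ hw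
  · rintro w (rfl | rfl) a
    · rw [reflection1_apply]
      exact .inr ⟨by congr 1; ring, rfl⟩
    · rw [reflection2_apply]
      exact .inl ⟨rfl, by rw [← abs_neg]; congr 1; ring⟩
  · intro a
    exact .inl ⟨rfl, rfl⟩
  · intro w₁ w₂ _ _ h₁ h₂ a
    have h := h₁ (w₂ a)
    have h' := h₂ a
    rw [LinearEquiv.mul_apply]
    unfold SignedPerm at *
    grind
  · intro w _ h a
    have h' := h (w⁻¹ a)
    rw [← LinearEquiv.mul_apply, mul_inv_cancel, LinearEquiv.coe_one, id] at h'
    unfold SignedPerm at *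
    grind

theorem exists_mem_weylGroup_of_signedPerm {a b : ℝ × ℝ} (h : SignedPerm a b) :
    ∃ w ∈ weylGroup, w a = b := by
  have swap : ∀ u v : ℝ, ∃ w ∈ weylGroup, w (ofOrtho u v) = ofOrtho v u := fun u v =>
    ⟨_, Subgroup.subset_closure (Or.inl rfl), by
      rw [reflection1_apply]; ext <;> simp [ofOrtho]; ring⟩
  have neg : ∀ u v : ℝ, ∃ w ∈ weylGroup, w (ofOrtho u v) = ofOrtho u (-v) := fun u v =>
    ⟨_, Subgroup.subset_closure (Or.inr rfl), by
      rw [reflection2_apply]; ext <;> simp [ofOrtho]; ring⟩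
  have trans : ∀ {x y z : ℝ × ℝ}, (∃ w ∈ weylGroup, w x = y) → (∃ w ∈ weylGroup, w y = z) →
      ∃ w ∈ weylGroup, w x = z := by
    rintro x y z ⟨w, hw, rfl⟩ ⟨w', hw', rfl⟩
    exact ⟨w' * w, mul_mem hw' hw, rfl⟩
  have snd : ∀ u v v' : ℝ, |v| = |v'| → ∃ w ∈ weylGroup, w (ofOrtho u v) = ofOrtho u v' := by
    intro u v v' hv
    rcases abs_eq_abs.1 hv with rfl | rfl
    · exact ⟨1, one_mem _, rfl⟩
    · simpa using neg u (-v')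
  have both : ∀ u v u' v' : ℝ, |u| = |u'| → |v| = |v'| →
      ∃ w ∈ weylGroup, w (ofOrtho u v) = ofOrtho u' v' := fun u v u' v' hu hv =>
    trans (snd u v v' hv) (trans (swap u v') (trans (snd v' u u' hu) (swap v' u')))
  have ha : a = ofOrtho a.1 (a.2 - a.1) := by ext <;> simp [ofOrtho]
  have hb : b = ofOrtho b.1 (b.2 - b.1) := by ext <;> simp [ofOrtho]
  rw [ha, hb]
  rcases h with ⟨h1, h2⟩ | ⟨h1, h2⟩
  · exact both _ _ _ _ h1 h2
  · exact trans (both _ _ _ _ h1 h2) (swap _ _)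

theorem exists_int_div_of_abs_eq {m : ℤ} {c u : ℝ} (h : |(m : ℝ) / c| = |u|) :
    ∃ k : ℤ, u = k / c := by
  rcases abs_eq_abs.1 h with h | h
  · exact ⟨m, h.symm⟩
  · exact ⟨-m, by push_cast; rw [neg_div, h, neg_neg]⟩

/-- Only absolute values can agree here: for `m = -M` the chosen representative is `M`. -/
theorem natAbs_valMinAbs_intCast {M : ℕ} {m : ℤ} (h : m.natAbs ≤ M) :
    (m : ZMod (2 * M)).valMinAbs.natAbs = m.natAbs := by
  have key : ((m.natAbs : ℕ) : ZMod (2 * M)).valMinAbs.natAbs = m.natAbs := by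
    rw [ZMod.valMinAbs_natCast_of_le_half (by omega), Int.natAbs_natCast]
  rcases Int.natAbs_eq m with hm | hm
  · conv_lhs => rw [hm]
    rwa [Int.cast_natCast]
  · conv_lhs => rw [hm]
    rwa [Int.cast_neg, Int.cast_natCast, ZMod.natAbs_valMinAbs_neg]

/-! ### Orbits of grid points on the torus. -/

section Orbits

variable {M : ℕ} [NeZero M]

/-- The point of the torus `ℝ² / Q^∨` with a given index in the full grid. -/
noncomputable def torusPoint (q : ZMod (2 * M) × ZMod (2 * M)) : (ℝ × ℝ) ⧸ corootLattice :=
  QuotientAddGroup.mk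
    (ofOrtho (q.1.valMinAbs / (2 * M)) (q.2.valMinAbs / (2 * M)))

theorem mk_ofOrtho_eq_iff (m n m' n' : ℤ) :
    (QuotientAddGroup.mk (ofOrtho (m / (2 * M)) (n / (2 * M))) : (ℝ × ℝ) ⧸ corootLattice) =
      QuotientAddGroup.mk (ofOrtho (m' / (2 * M)) (n' / (2 * M))) ↔
    (m : ZMod (2 * M)) = m' ∧ (n : ZMod (2 * M)) = n' := by
  have hM : (M : ℝ) ≠ 0 := Nat.cast_ne_zero.2 (NeZero.ne M)
  rw [QuotientAddGroup.eq, corootLattice, AddSubgroup.mem_prod, AddSubgroup.mem_zmultiples_iff,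
    AddSubgroup.mem_zmultiples_iff, ZMod.intCast_eq_intCast_iff_dvd_sub,
    ZMod.intCast_eq_intCast_iff_dvd_sub]
  simp only [zsmul_eq_mul, mul_one, ofOrtho, Prod.fst_add, Prod.snd_add, Prod.fst_neg,
    Prod.snd_neg]
  have e : ∀ k x y : ℤ, (k : ℝ) = -((x : ℝ) / (2 * M)) + y / (2 * M) ↔
      y - x = ((2 * M : ℕ) : ℤ) * k := by
    intro k x y
    rw [← @Int.cast_inj ℝ]
    push_cast
    field_simp
    constructor <;> intro h <;> linarith
  constructor
  · rintro ⟨⟨k, hk⟩, l, hl⟩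
    -- In coroot coordinates the point is `(u, u + v)`, so the shift of `v` is `l - k`.
    refine ⟨⟨k, (e k m m').1 hk⟩, ⟨l - k, (e (l - k) n n').1 ?_⟩⟩
    push_cast
    linarith
  · rintro ⟨⟨k, hk⟩, l, hl⟩
    have hk' := (e k m m').2 hk
    have hl' := (e l n n').2 hl
    refine ⟨⟨k, hk'⟩, k + l, ?_⟩
    push_cast
    linarith

theorem torusPoint_injective : Function.Injective (torusPoint (M := M)) := by
  intro q q' h
  have := (mk_ofOrtho_eq_iff _ _ _ _).1 h
  simpa [Prod.ext_iff] using this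

/-- The index of the point of the fundamental domain in the Weyl group orbit of a grid point. -/
def foldIndex (q : ZMod (2 * M) × ZMod (2 * M)) : ℕ × ℕ × ℕ :=
  let a := max q.1.valMinAbs.natAbs q.2.valMinAbs.natAbs
  let b := min q.1.valMinAbs.natAbs q.2.valMinAbs.natAbs
  (M - a, (a - b) / 2, b)

theorem natAbs_valMinAbs_le_half (m : ZMod (2 * M)) : m.valMinAbs.natAbs ≤ M := by
  have := ZMod.natAbs_valMinAbs_le m
  omega

theorem foldIndex_mem {q : ZMod (2 * M) × ZMod (2 * M)} (hq : q ∈ torusGrid M) :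
    foldIndex q ∈ indexSet M := by
  rw [mem_indexSet]
  simp only [torusGrid, Finset.mem_filter, Finset.mem_univ, true_and, Nat.even_iff] at hq
  have h1 := natAbs_valMinAbs_le_half q.1
  have h2 := natAbs_valMinAbs_le_half q.2
  simp only [foldIndex]
  omega

/-- Equal parity and the bound `M` on absolute values make the truncated subtractions and the
halving in `foldIndex` exact. -/
theorem mem_grid_and_foldIndex_eq_iff {s : ℕ × ℕ × ℕ} (hs : s ∈ indexSet M)
    (q : ZMod (2 * M) × ZMod (2 * M)) :
    (q ∈ torusGrid M ∧ foldIndex q = s) ↔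
      (2 * s.2.1 + s.2.2 = q.1.valMinAbs.natAbs ∧ s.2.2 = q.2.valMinAbs.natAbs) ∨
      (2 * s.2.1 + s.2.2 = q.2.valMinAbs.natAbs ∧ s.2.2 = q.1.valMinAbs.natAbs) := by
  obtain ⟨s₀, s₁, s₂⟩ := s
  rw [mem_indexSet] at hs
  have h1 := natAbs_valMinAbs_le_half q.1
  have h2 := natAbs_valMinAbs_le_half q.2
  simp only [torusGrid, Finset.mem_filter, Finset.mem_univ, true_and, Nat.even_iff, foldIndex,
    Prod.mk.injEq]
  dsimp only at hs
  omega

theorem gridPoint_eq (s : ℕ × ℕ × ℕ) :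
    gridPoint M s =
      ofOrtho (((2 * s.2.1 + s.2.2 : ℕ) : ℤ) / (2 * M)) ((s.2.2 : ℤ) / (2 * M)) := by
  have hM : (M : ℝ) ≠ 0 := Nat.cast_ne_zero.2 (NeZero.ne M)
  ext
  · simp [gridPoint, ofOrtho]
  · simp only [gridPoint, ofOrtho]
    push_cast
    field_simp
    ring

theorem signedPerm_ofOrtho_iff (m n m' n' : ℤ) :
    SignedPerm (ofOrtho (m / (2 * M)) (n / (2 * M))) (ofOrtho (m' / (2 * M)) (n' / (2 * M))) ↔
      (m.natAbs = m'.natAbs ∧ n.natAbs = n'.natAbs) ∨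
      (m.natAbs = n'.natAbs ∧ n.natAbs = m'.natAbs) := by
  have hM : (2 * M : ℝ) ≠ 0 := mul_ne_zero two_ne_zero (Nat.cast_ne_zero.2 (NeZero.ne M))
  have e : ∀ x y : ℤ, |(x : ℝ) / (2 * M)| = |(y : ℝ) / (2 * M)| ↔ x.natAbs = y.natAbs := by
    intro x y
    rw [abs_div, abs_div, div_left_inj' (abs_ne_zero.2 hM), ← Int.cast_abs, ← Int.cast_abs,
      Int.cast_inj, Int.abs_eq_natAbs, Int.abs_eq_natAbs, Int.natCast_inj]
  simp only [SignedPerm, ofOrtho, add_sub_cancel_left, e]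

theorem orbit_gridPoint_eq_image {s : ℕ × ℕ × ℕ} (hs : s ∈ indexSet M) :
    {q : (ℝ × ℝ) ⧸ corootLattice |
      ∃ w ∈ weylGroup, q = QuotientAddGroup.mk (w (gridPoint M s))} =
    torusPoint '' (((torusGrid M).filter fun q => foldIndex q = s :
      Finset (ZMod (2 * M) × ZMod (2 * M))) : Set (ZMod (2 * M) × ZMod (2 * M))) := by
  have hs' := (mem_indexSet M s).1 hs
  ext x
  simp only [Set.mem_ofPred_eq, Set.mem_image, Finset.coe_filter]
  constructor
  · rintro ⟨w, hw, rfl⟩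
    have hsp := signedPerm_of_mem_weylGroup hw (gridPoint M s)
    -- Signed permutations keep the coordinates in `ℤ / (2M)`, so each orbit point has an index
    -- modulo `2M`.
    obtain ⟨m, n, h⟩ : ∃ m n : ℤ,
        w (gridPoint M s) = ofOrtho (m / (2 * M)) (n / (2 * M)) := by
      rw [gridPoint_eq] at hsp ⊢
      generalize w _ = b at hsp
      simp only [SignedPerm, ofOrtho, add_sub_cancel_left] at hsp
      rcases hsp with ⟨h1, h2⟩ | ⟨h1, h2⟩
      · obtain ⟨m, hm⟩ := exists_int_div_of_abs_eq h1
        obtain ⟨n, hn⟩ := exists_int_div_of_abs_eq h2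
        exact ⟨m, n, by rw [← hm, ← hn]; ext <;> simp [ofOrtho]⟩
      · obtain ⟨n, hn⟩ := exists_int_div_of_abs_eq h1
        obtain ⟨m, hm⟩ := exists_int_div_of_abs_eq h2
        exact ⟨m, n, by rw [← hm, ← hn]; ext <;> simp [ofOrtho]⟩
    rw [h, gridPoint_eq, signedPerm_ofOrtho_iff, Int.natAbs_natCast, Int.natAbs_natCast] at hsp
    refine ⟨((m : ZMod (2 * M)), (n : ZMod (2 * M))), ?_, ?_⟩
    · refine (mem_grid_and_foldIndex_eq_iff hs _).2 ?_
      dsimp only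
      rw [natAbs_valMinAbs_intCast (by omega), natAbs_valMinAbs_intCast (by omega)]
      exact hsp
    · rw [h]
      exact (mk_ofOrtho_eq_iff _ _ _ _).2 ⟨ZMod.coe_valMinAbs _, ZMod.coe_valMinAbs _⟩
  · rintro ⟨q, hq, rfl⟩
    have hsp : SignedPerm (gridPoint M s)
        (ofOrtho (q.1.valMinAbs / (2 * M)) (q.2.valMinAbs / (2 * M))) := by
      rw [gridPoint_eq, signedPerm_ofOrtho_iff]
      exact (mem_grid_and_foldIndex_eq_iff hs q).1 hq
    obtain ⟨w, hw, h⟩ := exists_mem_weylGroup_of_signedPerm hsp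
    exact ⟨w, hw, by rw [h]; rfl⟩

theorem orbitSize_gridPoint {s : ℕ × ℕ × ℕ} (hs : s ∈ indexSet M) :
    orbitSize (gridPoint M s) = ((torusGrid M).filter fun q => foldIndex q = s).card := by
  rw [orbitSize, orbit_gridPoint_eq_image hs, Set.ncard_image_of_injective _ torusPoint_injective,
    Set.ncard_coe_finset]

theorem X_gridPoint_foldIndex {s : ℕ × ℕ × ℕ} (hs : s ∈ indexSet M)
    {q : ZMod (2 * M) × ZMod (2 * M)} (hq : q ∈ torusGrid M) (h : foldIndex q = s) :
    X (gridPoint M s) = (node q.1 + node q.2, node q.1 * node q.2) := by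
  have hnode : ∀ m : ZMod (2 * M), node m = 2 * cos (2 * π * (m.valMinAbs.natAbs / (2 * M))) := by
    intro m
    rw [node]
    push_cast
    rcases abs_choice (m.valMinAbs : ℝ) with h | h
    · rw [Nat.cast_natAbs, Int.cast_abs, h]; ring_nf
    · rw [Nat.cast_natAbs, Int.cast_abs, h, ← cos_neg]; ring_nf
  rw [X_eq_angleMap, gridPoint_eq, hnode, hnode]
  simp only [ofOrtho, add_sub_cancel_left, angleMap, Int.cast_natCast]
  rcases (mem_grid_and_foldIndex_eq_iff hs q).1 ⟨hq, h⟩ with ⟨h1, h2⟩ | ⟨h1, h2⟩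
  · rw [← h1, ← h2]
  · rw [← h1, ← h2, add_comm, mul_comm (2 * cos _) (2 * cos _)]

/-- The fibres of `foldIndex` partition the grid, and `X` is constant on each. -/
theorem sum_orbitSize_mul (f : ℝ × ℝ → ℂ) :
    ∑ s ∈ indexSet M, (orbitSize (gridPoint M s) : ℂ) * f (X (gridPoint M s)) =
      ∑ q ∈ torusGrid M, f (node q.1 + node q.2, node q.1 * node q.2) := by
  rw [← Finset.sum_fiberwise_of_maps_to (fun q hq => foldIndex_mem hq)]
  refine Finset.sum_congr rfl fun s hs => ?_
  rw [orbitSize_gridPoint hs, ← nsmul_eq_mul, ← Finset.sum_const]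
  refine Finset.sum_congr rfl fun q hq => ?_
  obtain ⟨h1, h2⟩ := Finset.mem_filter.1 hq
  rw [X_gridPoint_foldIndex hs h1 h2]

end Orbits

theorem continuous_evalAt (p : MvPolynomial (Fin 2) ℂ) : Continuous (evalAt p) := by
  unfold evalAt
  refine (MvPolynomial.continuous_eval p).comp (continuous_pi fun i => ?_)
  fin_cases i <;> simp <;> fun_prop

end C2

theorem mainTheorem3 :
    C2.Omega = {y : ℝ × ℝ | |y.1| ≤ 4 ∧ -2 * y.1 - 4 ≤ y.2 ∧ 2 * y.1 - 4 ≤ y.2 ∧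
      y.2 ≤ y.1 ^ 2 / 4} ∧
    ∀ M : ℕ, 0 < M → ∀ p ∈ C2.PolySpace (2 * M - 1),
      MeasureTheory.IntegrableOn
        (fun y : ℝ × ℝ => C2.evalAt p y * ((C2.K y ^ (-(1 / 2) : ℝ) : ℝ) : ℂ)) C2.Omega ∧
      ∫ y in C2.Omega, C2.evalAt p y * ((C2.K y ^ (-(1 / 2) : ℝ) : ℝ) : ℂ) =
        ((Real.pi ^ 2 / (4 * (M : ℝ) ^ 2) : ℝ) : ℂ) *
          ∑ s ∈ C2.indexSet M,
            (C2.orbitSize (C2.gridPoint M s) : ℂ) * C2.evalAt p (C2.X (C2.gridPoint M s)) := by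
  refine ⟨C2.Omega_eq_region, fun M hM p hp => ?_⟩
  have : NeZero M := ⟨hM.ne'⟩
  have hc := C2.continuous_evalAt p
  refine ⟨C2.integrableOn_Omega hc, ?_⟩
  have hsq := C2.integral_square_of_swap (g := fun t => C2.evalAt p (C2.angleMap t))
    (hc.comp C2.continuous_angleMap) fun t => by
      simp only [C2.angleMap, Prod.fst_swap, Prod.snd_swap, add_comm, mul_comm]
  rw [C2.integral_square_evalAt hp] at hsq
  rw [C2.integral_Omega, C2.sum_orbitSize_mul]
  push_cast
  -- The square counts the chamber twice, which turns `π² / (2M²)` into `π² / (4M²)`.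
  linear_combination (-1 / 2 : ℂ) * hsq
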